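/- A loopless mixed graph (LMG) has a finite node set and undirected ($i-j$), directed ($i\to j$) and bidirected ($i\leftrightarrow j$) edges between distinct nodes; edges of different types between the same two nodes are allowed. Paths have pairwise distinct nodes. A non-endpoint of a path is a collider on it if both path edges at it have an arrowhead there; a collider path is a path all of whose non-endpoints are colliders. We call $i$ an ancestor of $j$, and $j$ a descendant of $i$, if there is a directed path from $i$ to $j$ with at least one edge. A path is $m$-connecting given $C$ if each of its colliders lies in $C$ or is an ancestor of a node of $C$, and none of its other nodes (endpoints included) lies in $C$. The independence model $\mathcal J(\mathcal G)$ is the set of triples $\langle A,B\mid C\rangle$ of pairwise disjoint node sets such that no path between a node of $A$ and a node of $B$ is $m$-connecting given $C$; two graphs are Markov equivalent if they have the same independence model. An LMG is maximal if adding any edge between two nonadjacent nodes changes its independence model. An LMG is ancestral if it has no directed cycle, if $i\leftrightarrow j$ implies that neither of $i,j$ is an ancestor of the other, and if $i-j$ implies that no edge has an arrowhead at $i$ or $j$. It is ribbonless if it contains no collider path $\langle i,j,k\rangle$ such that there is no edge between $i$ and $k$ with the same arrowheads at $i$ and at $k$ as the path, and $j$ or a descendant of $j$ is an endpoint of an undirected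 edge or on a directed cycle. An inducing path between $i$ and $j$ is a path each of whose non-endpoints is a collider on it and an ancestor of $i$ or of $j$. A maximal extension of an LMG $\mathcal G$ is a maximal ribbonless graph that contains $\mathcal G$, is Markov equivalent to $\mathcal G$, and arises from $\mathcal G$ by adding edges, each joining the nonadjacent endpoints of some inducing path in $\mathcal G$ and having the same arrowheads at its endpoints as that path. Let $\mathcal I$ be a finite multiset of subsets of the node set $[p]$ of an LMG $\mathcal G$. The interventional graph $\mathcal G^{\mathcal I}$ is obtained from $\mathcal G$ by adding a node $\omega_I$ for each nonempty element $I$ of the multiset $\mathcal I$, and the edges $\omega_I\to i$ for $i\in I$. **Proposition.** Let $\mathcal G=([p],E)$ be an ancestral graph, and let $\mathcal I$ be such that no endpoint of an undirected edge of $\mathcal G$ belongs to two distinct elements of the multiset $\mathcal I$. Then $\mathcal G$ has exactly one maximal extension $\overline{\mathcal G}$, which is also the only maximal ancestral graph that contains $\mathcal G$ and is Markov equivalent to $\mathcal G$; the graph $\mathcal G^{\mathcal I}$ has exactly one maximal extension $\overline{\mathcal G^{\mathcal I}}$; and $$\overline{\mathcal G}^{\,\mathcal I}=\overline{\mathcal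 G^{\mathcal I}}.$$ -/

import Mathlib

/-- A loopless mixed graph on the node set `V`: undirected edges `i - j`, directed edges `i → j`
and bidirected edges `i ↔ j`. Edges of different types between the same two nodes are allowed. -/
@[ext]
structure LMG (V : Type*) where
  und : V → V → Prop
  dir : V → V → Prop
  bid : V → V → Prop
  und_symm : ∀ i j, und i j → und j i
  bid_symm : ∀ i j, bid i j → bid j i
  und_loopless : ∀ i, ¬ und i i
  dir_loopless : ∀ i, ¬ dir i i
  bid_loopless : ∀ i, ¬ bid i i

/-- The four ways in which an edge can be traversed from `i` to `j`:
`i - j`, `i → j`, `i ← j`, `i ↔ j`. -/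
inductive EdgeType
  | und
  | fwd
  | bwd
  | bid

namespace EdgeType

/-- The edge has an arrowhead at the node where the traversal starts. -/
def HeadAtStart : EdgeType → Prop
  | und => False
  | fwd => False
  | bwd => True
  | bid => True

/-- The edge has an arrowhead at the node where the traversal ends. -/
def HeadAtEnd : EdgeType → Prop
  | und => False
  | fwd => True
  | bwd => False
  | bid => True

end EdgeType

namespace LMG

variable {V : Type*}

/-- `G` contains the edge of type `e` between `i` and `j`, read from `i` to `j`. -/
def HasEdge (G : LMG V) : EdgeType → V → V → Prop
  | .und, i, j => G.und i j
  | .fwd, i, j => G.dir i j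
  | .bwd, i, j => G.dir j i
  | .bid, i, j => G.bid i j

/-- Two nodes are adjacent if they are the endpoints of some edge. -/
def Adj (G : LMG V) (i j : V) : Prop := ∃ e, G.HasEdge e i j

/-- Every edge of `G` is an edge of `H`. -/
def IsContainedIn (G H : LMG V) : Prop := ∀ e i j, G.HasEdge e i j → H.HasEdge e i j

/-- The graph obtained from `G` by adding the edge of type `e` between `a` and `b`. -/
def addEdge (G : LMG V) (e : EdgeType) (a b : V) (hab : a ≠ b) : LMG V where
  und i j := G.und i j ∨ (e = .und ∧ ((i = a ∧ j = b) ∨ (i = b ∧ j = a)))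
  dir i j := G.dir i j ∨ (e = .fwd ∧ i = a ∧ j = b) ∨ (e = .bwd ∧ i = b ∧ j = a)
  bid i j := G.bid i j ∨ (e = .bid ∧ ((i = a ∧ j = b) ∨ (i = b ∧ j = a)))
  und_symm := by
    rintro i j (h | ⟨h, h'⟩)
    · exact Or.inl (G.und_symm _ _ h)
    · exact Or.inr ⟨h, by tauto⟩
  bid_symm := by
    rintro i j (h | ⟨h, h'⟩)
    · exact Or.inl (G.bid_symm _ _ h)
    · exact Or.inr ⟨h, by tauto⟩
  und_loopless := by
    rintro i (h | ⟨-, ⟨rfl, h⟩ | ⟨rfl, h⟩⟩)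
    · exact G.und_loopless _ h
    · exact hab h
    · exact hab h.symm
  dir_loopless := by
    rintro i (h | ⟨-, rfl, h⟩ | ⟨-, rfl, h⟩)
    · exact G.dir_loopless _ h
    · exact hab h
    · exact hab h.symm
  bid_loopless := by
    rintro i (h | ⟨-, ⟨rfl, h⟩ | ⟨rfl, h⟩⟩)
    · exact G.bid_loopless _ h
    · exact hab h
    · exact hab h.symm

/-- `i` is an ancestor of `j`: there is a directed path from `i` to `j` with at least one edge.
(`G.Ancestor i i` means that `i` lies on a directed cycle.) -/
def Ancestor (G : LMG V) : V → V → Prop := Relation.TransGen G.dir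

/-- A path between `a` and `b`: pairwise distinct nodes `vert 0 = a, …, vert len = b`, and for
each `k < len` an edge of `G` between `vert k` and `vert (k + 1)`. The values of `vert` beyond
`len` and of `edge` from `len` on are irrelevant. -/
structure Path (G : LMG V) (a b : V) where
  len : ℕ
  vert : ℕ → V
  edge : ℕ → EdgeType
  vert_zero : vert 0 = a
  vert_len : vert len = b
  hasEdge : ∀ k < len, G.HasEdge (edge k) (vert k) (vert (k + 1))
  nodup : ∀ k ≤ len, ∀ l ≤ len, vert k = vert l → k = l

namespace Path

variable {G : LMG V} {a b : V}

/-- The `k`-th node of the path is not an endpoint of it, and both edges of the path at this node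
have an arrowhead there. -/
def IsCollider (π : G.Path a b) (k : ℕ) : Prop :=
  0 < k ∧ k < π.len ∧ (π.edge (k - 1)).HeadAtEnd ∧ (π.edge k).HeadAtStart

/-- The path is `m`-connecting given `C`: every collider is in `C` or an ancestor of a node in `C`,
and no other node (endpoints included) is in `C`. -/
def MConnecting (π : G.Path a b) (C : Set V) : Prop :=
  ∀ k ≤ π.len,
    (π.IsCollider k → π.vert k ∈ C ∨ ∃ c ∈ C, G.Ancestor (π.vert k) c) ∧
    (¬ π.IsCollider k → π.vert k ∉ C)

/-- An inducing path: every non-endpoint is a collider and an ancestor of an endpoint. -/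
def IsInducing (π : G.Path a b) : Prop :=
  ∀ k, 0 < k → k < π.len →
    π.IsCollider k ∧ (G.Ancestor (π.vert k) a ∨ G.Ancestor (π.vert k) b)

/-- An edge of type `e` from `a` to `b` is endpoint-identical to the path: it has an arrowhead at
`a` iff the first edge of the path has, and an arrowhead at `b` iff the last edge has. -/
def EndpointIdentical (π : G.Path a b) (e : EdgeType) : Prop :=
  0 < π.len ∧ (e.HeadAtStart ↔ (π.edge 0).HeadAtStart) ∧
    (e.HeadAtEnd ↔ (π.edge (π.len - 1)).HeadAtEnd)

end Path

/-- `C` `m`-separates `A` and `B`. -/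
def MSeparates (G : LMG V) (A B C : Set V) : Prop :=
  ∀ a ∈ A, ∀ b ∈ B, ∀ π : G.Path a b, ¬ π.MConnecting C

/-- The formal independence model of `G`: the triples `⟨A, B | C⟩` of pairwise disjoint sets of
nodes such that `C` `m`-separates `A` and `B`. -/
def independenceModel (G : LMG V) : Set (Set V × Set V × Set V) :=
  {t | Disjoint t.1 t.2.1 ∧ Disjoint t.1 t.2.2 ∧ Disjoint t.2.1 t.2.2 ∧
    G.MSeparates t.1 t.2.1 t.2.2}

/-- Markov equivalence. -/
def MarkovEquiv (G H : LMG V) : Prop := G.independenceModel = H.independenceModel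

/-- `G` is maximal: adding any edge between two nonadjacent nodes changes the independence
model. -/
def IsMaximal (G : LMG V) : Prop :=
  ∀ (e : EdgeType) (a b : V) (hab : a ≠ b), ¬ G.Adj a b →
    ¬ (G.addEdge e a b hab).MarkovEquiv G

/-- Ancestral graphs. -/
structure IsAncestral (G : LMG V) : Prop where
  no_directed_cycle : ∀ i, ¬ G.Ancestor i i
  bid_not_ancestor : ∀ i j, G.bid i j → ¬ G.Ancestor i j ∧ ¬ G.Ancestor j i
  und_no_arrowhead : ∀ i j, G.und i j → ∀ k,
    ¬ G.dir k i ∧ ¬ G.bid k i ∧ ¬ G.dir k j ∧ ¬ G.bid k j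

/-- The node `i` is an endpoint of an undirected edge. -/
def SelectionAdjacent (G : LMG V) (i : V) : Prop := ∃ j, G.und i j

/-- The triple `⟨i, j, k⟩`, with the edges read from `i` to `j` as `e` and from `j` to `k` as `f`,
is a ribbon: a collider path without an endpoint-identical edge between `i` and `k` such that `j`
or a descendant of `j` is an endpoint of an undirected edge or on a directed cycle. -/
def IsRibbon (G : LMG V) (i j k : V) (e f : EdgeType) : Prop :=
  i ≠ k ∧ G.HasEdge e i j ∧ G.HasEdge f j k ∧ e.HeadAtEnd ∧ f.HeadAtStart ∧
  (¬ ∃ g : EdgeType, G.HasEdge g i k ∧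
    (g.HeadAtStart ↔ e.HeadAtStart) ∧ (g.HeadAtEnd ↔ f.HeadAtEnd)) ∧
  ∃ d, (d = j ∨ G.Ancestor j d) ∧ (G.SelectionAdjacent d ∨ G.Ancestor d d)

/-- Ribbonless graphs. -/
def IsRibbonless (G : LMG V) : Prop := ∀ i j k e f, ¬ G.IsRibbon i j k e f

/-- `H` is a maximal ancestral graph that contains `G` and is Markov equivalent to `G`. -/
structure IsMaximalAncestralExtension (G H : LMG V) : Prop where
  contains : G.IsContainedIn H
  ancestral : H.IsAncestral
  maximal : H.IsMaximal
  markovEquiv : H.MarkovEquiv G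

/-- `H` is a maximal ribbonless graph that contains `G`, is Markov equivalent to `G`, and arises
from `G` by adding, between nonadjacent endpoints of inducing paths in `G`, edges that are
endpoint-identical to these paths. -/
structure IsMaximalRibbonlessExtension (G H : LMG V) : Prop where
  contains : G.IsContainedIn H
  ribbonless : H.IsRibbonless
  maximal : H.IsMaximal
  markovEquiv : H.MarkovEquiv G
  added : ∀ e a b, H.HasEdge e a b → ¬ G.HasEdge e a b →
    ¬ G.Adj a b ∧ ∃ π : G.Path a b, π.IsInducing ∧ π.EndpointIdentical e

variable {ι : Type*}

/-- The interventional graph `G^I`. The multiset `I` of intervention targets is an indexed family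
`I : ι → Set V`, so that equal targets with different indices count as distinct elements. The new
nodes are the `ω_t` for the indices `t` with `I t ≠ ∅`, and the new edges are `ω_t → i` for
`i ∈ I t`. -/
def interventional (G : LMG V) (I : ι → Set V) : LMG (V ⊕ {t : ι // (I t).Nonempty}) where
  und x y := ∃ i j, x = Sum.inl i ∧ y = Sum.inl j ∧ G.und i j
  dir x y := (∃ i j, x = Sum.inl i ∧ y = Sum.inl j ∧ G.dir i j) ∨
    ∃ t i, x = Sum.inr t ∧ y = Sum.inl i ∧ i ∈ I t.1
  bid x y := ∃ i j, x = Sum.inl i ∧ y = Sum.inl j ∧ G.bid i j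
  und_symm := by
    rintro _ _ ⟨i, j, rfl, rfl, h⟩
    exact ⟨j, i, rfl, rfl, G.und_symm _ _ h⟩
  bid_symm := by
    rintro _ _ ⟨i, j, rfl, rfl, h⟩
    exact ⟨j, i, rfl, rfl, G.bid_symm _ _ h⟩
  und_loopless := by
    rintro _ ⟨i, j, rfl, h, h'⟩
    cases h
    exact G.und_loopless _ h'
  dir_loopless := by
    rintro _ (⟨i, j, rfl, h, h'⟩ | ⟨t, i, rfl, h, -⟩)
    · cases h
      exact G.dir_loopless _ h'
    · cases h
  bid_loopless := by
    rintro _ ⟨i, j, rfl, h, h'⟩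
    cases h
    exact G.bid_loopless _ h'

/-- The targets `I` doubly-intervene on `i`: two distinct members of the family contain `i`. -/
def DoublyIntervenes (I : ι → Set V) (i : V) : Prop := ∃ s t, s ≠ t ∧ i ∈ I s ∧ i ∈ I t

end LMG

/-!
Call an arrowhead ancestral if the node carrying it is no ancestor of the other endpoint of its
edge. When all arrowheads are ancestral, an inducing path between nonadjacent nodes consists of
bidirected edges only, so the sole candidate for a maximal extension is the graph `bidClosure`
obtained by joining the endpoints of each such path by `↔`.

If moreover no collider reaches an undirected edge along directed edges, then a walk satisfying the
conditions of `m`-connection can be shortened to a path: cutting a closed loop at `v` could only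
spoil `v` by turning it into a collider that is no ancestor of `C`, but then the loop leaves `v`
through a tail and has to follow directed edges all the way back to `v`. Hence the new edges
`i ↔ j`, which can be replaced by detours around the inducing paths, do not change the independence
model; and nonadjacent nodes of `bidClosure` are separated by the nodes that reach one of them, or
an undirected edge, along directed edges. A new node `ω_I` carries no arrowhead, so it lies on no
bidirected path, and the construction commutes with passing to the interventional graph.
-/

namespace EdgeType

/-- The same edge, traversed in the opposite direction. -/
def flip : EdgeType → EdgeType
  | und => und
  | fwd => bwd
  | bwd => fwd
  | bid => bid

theorem headAtStart_flip (e : EdgeType) : e.flip.HeadAtStart = e.HeadAtEnd := by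
  cases e <;> rfl

theorem headAtEnd_flip (e : EdgeType) : e.flip.HeadAtEnd = e.HeadAtStart := by
  cases e <;> rfl

theorem eq_of_heads {e f : EdgeType} (hs : e.HeadAtStart ↔ f.HeadAtStart)
    (he : e.HeadAtEnd ↔ f.HeadAtEnd) : e = f := by
  cases e <;> cases f <;> simp_all only [HeadAtStart, HeadAtEnd, iff_true, iff_false, not_true]

theorem eq_bid {e : EdgeType} (hs : e.HeadAtStart) (he : e.HeadAtEnd) : e = bid :=
  eq_of_heads (iff_of_true hs trivial) (iff_of_true he trivial)

end EdgeType

namespace LMG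

variable {V W : Type*} {G H : LMG V}

section Edges

variable {e f : EdgeType} {i j : V}

theorem HasEdge.flip (h : G.HasEdge e i j) : G.HasEdge e.flip j i := by
  cases e
  exacts [G.und_symm _ _ h, h, h, G.bid_symm _ _ h]

theorem HasEdge.ne (h : G.HasEdge e i j) : i ≠ j := by
  rintro rfl
  cases e
  exacts [G.und_loopless _ h, G.dir_loopless _ h, G.dir_loopless _ h, G.bid_loopless _ h]

theorem HasEdge.und_or_dir_of_not_headAtStart (h : G.HasEdge e i j) (he : ¬ e.HeadAtStart) :
    (G.und i j ∧ ¬ e.HeadAtEnd) ∨ (G.dir i j ∧ e.HeadAtEnd) := by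
  cases e
  exacts [Or.inl ⟨h, id⟩, Or.inr ⟨h, trivial⟩, (he trivial).elim, (he trivial).elim]

theorem Adj.symm (h : G.Adj i j) : G.Adj j i :=
  h.elim fun _ he => ⟨_, he.flip⟩

/-- Some edge between `i` and `j` has an arrowhead at `j`. -/
def Into (G : LMG V) (i j : V) : Prop := G.dir i j ∨ G.bid i j

theorem HasEdge.into_of_headAtEnd (h : G.HasEdge e i j) (he : e.HeadAtEnd) : G.Into i j := by
  cases e
  exacts [he.elim, Or.inl h, he.elim, Or.inr h]

theorem HasEdge.into_of_headAtStart (h : G.HasEdge e i j) (he : e.HeadAtStart) : G.Into j i :=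
  h.flip.into_of_headAtEnd (e.headAtEnd_flip ▸ he)

theorem IsContainedIn.ancestor (hGH : G.IsContainedIn H) (h : G.Ancestor i j) : H.Ancestor i j :=
  Relation.TransGen.mono (hGH .fwd) _ _ h

theorem IsContainedIn.antisymm (hGH : G.IsContainedIn H) (hHG : H.IsContainedIn G) : G = H := by
  refine LMG.ext ?_ ?_ ?_ <;> ext i j
  exacts [⟨hGH .und i j, hHG .und i j⟩, ⟨hGH .fwd i j, hHG .fwd i j⟩,
    ⟨hGH .bid i j, hHG .bid i j⟩]

theorem isContainedIn_addEdge (hij : i ≠ j) : G.IsContainedIn (G.addEdge e i j hij) := by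
  rintro (_ | _ | _ | _) k l h <;> exact Or.inl h

theorem addEdge_isContainedIn (hGH : G.IsContainedIn H) (h : H.HasEdge e i j) :
    (G.addEdge e i j h.ne).IsContainedIn H := by
  rintro (_ | _ | _ | _) k l hkl
  · rcases hkl with hkl | ⟨rfl, ⟨rfl, rfl⟩ | ⟨rfl, rfl⟩⟩
    exacts [hGH .und _ _ hkl, h, H.und_symm _ _ h]
  · rcases hkl with hkl | ⟨rfl, rfl, rfl⟩ | ⟨rfl, rfl, rfl⟩
    exacts [hGH .fwd _ _ hkl, h, h]
  · rcases hkl with hkl | ⟨rfl, rfl, rfl⟩ | ⟨rfl, rfl, rfl⟩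
    exacts [hGH .bwd _ _ hkl, h, h]
  · rcases hkl with hkl | ⟨rfl, ⟨rfl, rfl⟩ | ⟨rfl, rfl⟩⟩
    exacts [hGH .bid _ _ hkl, h, H.bid_symm _ _ h]

theorem hasEdge_addEdge (hij : i ≠ j) : (G.addEdge e i j hij).HasEdge e i j := by
  cases e
  exacts [Or.inr ⟨rfl, Or.inl ⟨rfl, rfl⟩⟩, Or.inr (Or.inl ⟨rfl, rfl, rfl⟩),
    Or.inr (Or.inr ⟨rfl, rfl, rfl⟩), Or.inr ⟨rfl, Or.inl ⟨rfl, rfl⟩⟩]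

end Edges

section Ancestral

variable {e f : EdgeType} {i j : V}

/-- A node at which an edge has an arrowhead is not an ancestor of the other endpoint. This is the
part of the definition of ancestral graphs that does not concern undirected edges. -/
def HasAncestralArrowheads (G : LMG V) : Prop := ∀ ⦃i j⦄, G.Into i j → ¬ G.Ancestor j i

theorem HasAncestralArrowheads.not_ancestor_self (hG : G.HasAncestralArrowheads) (i : V) :
    ¬ G.Ancestor i i := by
  intro h
  obtain ⟨j, hij, hji⟩ := Relation.TransGen.tail'_iff.1 h
  rcases Relation.reflTransGen_iff_eq_or_transGen.1 hij with rfl | hij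
  exacts [G.dir_loopless _ hji, hG (Or.inl hji) hij]

theorem isAncestral_iff : G.IsAncestral ↔
    G.HasAncestralArrowheads ∧ ∀ i, G.SelectionAdjacent i → ∀ k, ¬ G.Into k i := by
  constructor
  · rintro ⟨hcycle, hbid, hund⟩
    refine ⟨?_, ?_⟩
    · rintro i j (h | h) hji
      exacts [hcycle i (hji.head h), (hbid i j h).2 hji]
    · rintro i ⟨j, h⟩ k (hk | hk)
      exacts [(hund i j h k).1 hk, (hund i j h k).2.1 hk]
  · rintro ⟨hG, hund⟩
    refine ⟨hG.not_ancestor_self, fun i j h => ⟨hG (Or.inr (G.bid_symm _ _ h)), hG (Or.inr h)⟩,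
      fun i j h k => ?_⟩
    have hi := hund i ⟨j, h⟩ k
    have hj := hund j ⟨i, G.und_symm _ _ h⟩ k
    exact ⟨fun h => hi (Or.inl h), fun h => hi (Or.inr h), fun h => hj (Or.inl h),
      fun h => hj (Or.inr h)⟩

theorem IsAncestral.hasAncestralArrowheads (hG : G.IsAncestral) : G.HasAncestralArrowheads :=
  (isAncestral_iff.1 hG).1

theorem IsAncestral.not_into (hG : G.IsAncestral) (hi : G.SelectionAdjacent i) (k : V) :
    ¬ G.Into k i :=
  (isAncestral_iff.1 hG).2 i hi k

theorem IsAncestral.headAtEnd_iff_into (hG : G.IsAncestral) (he : G.HasEdge e i j) :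
    e.HeadAtEnd ↔ G.Into i j := by
  refine ⟨he.into_of_headAtEnd, fun hinto => ?_⟩
  cases e
  · exact (hG.not_into ⟨i, G.und_symm _ _ he⟩ i hinto).elim
  · trivial
  · exact (hG.hasAncestralArrowheads hinto (.single he)).elim
  · trivial

theorem IsAncestral.headAtStart_iff_into (hG : G.IsAncestral) (he : G.HasEdge e i j) :
    e.HeadAtStart ↔ G.Into j i := by
  rw [← e.headAtEnd_flip, hG.headAtEnd_iff_into he.flip]

theorem IsAncestral.edge_unique (hG : G.IsAncestral) (he : G.HasEdge e i j)
    (hf : G.HasEdge f i j) : e = f :=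
  EdgeType.eq_of_heads ((hG.headAtStart_iff_into he).trans (hG.headAtStart_iff_into hf).symm)
    ((hG.headAtEnd_iff_into he).trans (hG.headAtEnd_iff_into hf).symm)

/-- Neither `i` nor a descendant of `i` is an endpoint of an undirected edge. -/
def SelectionFree (G : LMG V) (i : V) : Prop :=
  ∀ d, Relation.ReflTransGen G.dir i d → ¬ G.SelectionAdjacent d

theorem SelectionFree.of_ancestor (hi : G.SelectionFree i) (h : G.Ancestor i j) :
    G.SelectionFree j :=
  fun d hd => hi d (h.to_reflTransGen.trans hd)

/-- All arrowheads are ancestral, and the middle node of a collider path `⟨i, j, k⟩` is selection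
free whether or not there is an endpoint-identical edge between `i` and `k`. This class contains
the ancestral graphs and, for suitable targets, their interventional graphs. -/
structure IsStronglyRibbonless (G : LMG V) : Prop where
  hasAncestralArrowheads : G.HasAncestralArrowheads
  selectionFree : ∀ ⦃i j k⦄, i ≠ k → G.Into i j → G.Into k j → G.SelectionFree j

theorem IsStronglyRibbonless.isRibbonless (hG : G.IsStronglyRibbonless) : G.IsRibbonless := by
  rintro i j k e f ⟨hik, he, hf, hej, hfj, -, d, hd, hsel | hcycle⟩
  · exact hG.selectionFree hik (he.into_of_headAtEnd hej) (hf.into_of_headAtStart hfj) d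
      (Relation.reflTransGen_iff_eq_or_transGen.2 hd) hsel
  · exact hG.hasAncestralArrowheads.not_ancestor_self d hcycle

theorem IsAncestral.selectionFree_of_into (hG : G.IsAncestral) (h : G.Into i j) :
    G.SelectionFree j := by
  intro d hjd hd
  rcases Relation.ReflTransGen.cases_tail hjd with rfl | ⟨k, -, hk⟩
  exacts [hG.not_into hd i h, hG.not_into hd k (Or.inl hk)]

theorem IsAncestral.isStronglyRibbonless (hG : G.IsAncestral) : G.IsStronglyRibbonless :=
  ⟨hG.hasAncestralArrowheads, fun _ _ _ _ h _ => hG.selectionFree_of_into h⟩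

end Ancestral

namespace Path

variable {a b c : V} {e : EdgeType}

/-- The path without edges. -/
def nil (G : LMG V) (a : V) : G.Path a a where
  len := 0
  vert _ := a
  edge _ := .und
  vert_zero := rfl
  vert_len := rfl
  hasEdge k hk := (Nat.not_lt_zero k hk).elim
  nodup k hk l hl _ := by omega

/-- The path that starts with the edge `h` and continues along `π`. -/
def cons (h : G.HasEdge e a b) (π : G.Path b c) (ha : ∀ k ≤ π.len, π.vert k ≠ a) :
    G.Path a c where
  len := π.len + 1
  vert
    | 0 => a
    | k + 1 => π.vert k
  edge
    | 0 => e
    | k + 1 => π.edge k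
  vert_zero := rfl
  vert_len := π.vert_len
  hasEdge
    | 0, _ => by simpa only [π.vert_zero] using h
    | k + 1, hk => π.hasEdge k (by omega)
  nodup
    | 0, _, 0, _, _ => rfl
    | 0, _, l + 1, hl, hkl => (ha l (by omega) hkl.symm).elim
    | k + 1, hk, 0, _, hkl => (ha k (by omega) hkl).elim
    | k + 1, hk, l + 1, hl, hkl => congrArg (· + 1) (π.nodup k (by omega) l (by omega) hkl)

/-- The path that consists of a single edge. -/
def ofEdge (h : G.HasEdge e a b) : G.Path a b :=
  cons h (nil G b) fun _ _ => h.ne.symm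

/-- The part of the path from its `k`-th node on. -/
def drop (π : G.Path a b) (k : ℕ) (hk : k ≤ π.len) : G.Path (π.vert k) b where
  len := π.len - k
  vert l := π.vert (k + l)
  edge l := π.edge (k + l)
  vert_zero := rfl
  vert_len := by rw [Nat.add_sub_cancel' hk, π.vert_len]
  hasEdge l hl := π.hasEdge (k + l) (by omega)
  nodup l hl m hm h := Nat.add_left_cancel (π.nodup _ (by omega) _ (by omega) h)

/-- The path, traversed in the opposite direction. -/
def reverse (π : G.Path a b) : G.Path b a where
  len := π.len
  vert k := π.vert (π.len - k)
  edge k := (π.edge (π.len - 1 - k)).flip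
  vert_zero := π.vert_len
  vert_len := by rw [Nat.sub_self, π.vert_zero]
  hasEdge k hk := by
    have h := (π.hasEdge (π.len - 1 - k) (by omega)).flip
    rwa [show π.len - 1 - k + 1 = π.len - k by omega,
      show π.vert (π.len - 1 - k) = π.vert (π.len - (k + 1)) by rw [Nat.sub_sub, add_comm]] at h
  nodup k hk l hl h := by
    have := π.nodup _ (by omega) _ (by omega) h
    omega

/-- The image of a path under an injective map of the nodes that preserves edges. -/
def map {K : LMG W} (f : V ↪ W) (hf : ∀ e i j, G.HasEdge e i j → K.HasEdge e (f i) (f j))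
    (π : G.Path a b) : K.Path (f a) (f b) where
  len := π.len
  vert k := f (π.vert k)
  edge := π.edge
  vert_zero := congrArg f π.vert_zero
  vert_len := congrArg f π.vert_len
  hasEdge k hk := hf _ _ _ (π.hasEdge k hk)
  nodup k hk l hl h := π.nodup k hk l hl (f.injective h)

theorem len_pos (π : G.Path a b) (hab : a ≠ b) : 0 < π.len := by
  refine Nat.pos_of_ne_zero fun h => hab ?_
  rw [← π.vert_zero, ← h, π.vert_len]

theorem two_le_len (π : G.Path a b) (hab : a ≠ b) (hadj : ¬ G.Adj a b) : 2 ≤ π.len := by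
  by_contra hlt
  have hlen : 1 = π.len := by have := π.len_pos hab; omega
  have hedge := π.hasEdge 0 (by omega)
  rw [zero_add, π.vert_zero, hlen, π.vert_len] at hedge
  exact hadj ⟨_, hedge⟩

theorem vert_ne_left (π : G.Path a b) {k : ℕ} (h0 : 0 < k) (hk : k ≤ π.len) : π.vert k ≠ a :=
  fun h => h0.ne' (π.nodup k hk 0 (Nat.zero_le _) (h.trans π.vert_zero.symm))

theorem vert_ne_right (π : G.Path a b) {k : ℕ} (hk : k < π.len) : π.vert k ≠ b :=
  fun h => hk.ne (π.nodup k hk.le π.len le_rfl (h.trans π.vert_len.symm))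

theorem hasEdge_first (π : G.Path a b) (h : 0 < π.len) :
    G.HasEdge (π.edge 0) a (π.vert 1) := by
  simpa only [π.vert_zero] using π.hasEdge 0 h

theorem hasEdge_last (π : G.Path a b) (h : 0 < π.len) :
    G.HasEdge (π.edge (π.len - 1)) (π.vert (π.len - 1)) b := by
  simpa only [Nat.sub_add_cancel h, π.vert_len] using π.hasEdge (π.len - 1) (by omega)

theorem isCollider_succ {π : G.Path a b} {k : ℕ} : π.IsCollider (k + 1) ↔
    k + 1 < π.len ∧ (π.edge k).HeadAtEnd ∧ (π.edge (k + 1)).HeadAtStart :=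
  and_iff_right k.succ_pos

theorem IsCollider.exists_into {π : G.Path a b} {k : ℕ} (h : π.IsCollider k) :
    ∃ i j, i ≠ j ∧ G.Into i (π.vert k) ∧ G.Into j (π.vert k) := by
  obtain ⟨h0, hk, hin, hout⟩ := h
  obtain ⟨k, rfl⟩ := Nat.exists_eq_add_one_of_ne_zero h0.ne'
  refine ⟨π.vert k, π.vert (k + 1 + 1), fun h => ?_,
    (π.hasEdge k (by omega)).into_of_headAtEnd hin, (π.hasEdge (k + 1) hk).into_of_headAtStart hout⟩
  have := π.nodup k (by omega) _ (by omega) h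
  omega

theorem IsCollider.reverse {π : G.Path a b} {k : ℕ} (h : π.IsCollider k) :
    π.reverse.IsCollider (π.len - k) := by
  obtain ⟨h0, hk, hin, hout⟩ := h
  refine ⟨by omega, show π.len - k < π.len by omega, ?_, ?_⟩
  · change (π.edge (π.len - 1 - (π.len - k - 1))).flip.HeadAtEnd
    rwa [EdgeType.headAtEnd_flip, show π.len - 1 - (π.len - k - 1) = k by omega]
  · change (π.edge (π.len - 1 - (π.len - k))).flip.HeadAtStart
    rwa [EdgeType.headAtStart_flip, show π.len - 1 - (π.len - k) = k - 1 by omega]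

end Path

section Inducing

variable {a b : V} {e : EdgeType} {π : G.Path a b}

theorem Path.IsInducing.reverse (hπ : π.IsInducing) : π.reverse.IsInducing := by
  intro k h0 (hk : k < π.len)
  obtain ⟨hcol, hanc⟩ := hπ (π.len - k) (by omega) (by omega)
  have hrev := hcol.reverse
  rw [Nat.sub_sub_self hk.le] at hrev
  exact ⟨hrev, hanc.symm⟩

theorem Path.IsInducing.map {K : LMG W} {f : V ↪ W}
    (hf : ∀ e i j, G.HasEdge e i j → K.HasEdge e (f i) (f j)) (hπ : π.IsInducing) :
    (π.map f hf).IsInducing := by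
  intro k h0 hk
  have lift {i j : V} : G.Ancestor i j → K.Ancestor (f i) (f j) :=
    Relation.TransGen.lift f (hf .fwd) _ _
  exact ⟨(hπ k h0 hk).1, (hπ k h0 hk).2.imp lift lift⟩

namespace HasAncestralArrowheads

theorem ancestor_of_isInducing (hG : G.HasAncestralArrowheads) (hπ : π.IsInducing)
    (hlen : 2 ≤ π.len) : G.Ancestor (π.vert 1) b := by
  obtain ⟨⟨-, -, hin, -⟩, hanc⟩ := hπ 1 (by omega) (by omega)
  exact hanc.resolve_left
    (hG ((π.hasEdge_first (by omega)).into_of_headAtEnd hin))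

theorem not_ancestor_of_isInducing (hG : G.HasAncestralArrowheads) (hπ : π.IsInducing)
    (hlen : 2 ≤ π.len) : ¬ G.Ancestor a b := by
  intro hab
  obtain ⟨⟨-, -, -, hout⟩, hanc⟩ := hπ (π.len - 1) (by omega) (by omega)
  refine hG ((π.hasEdge_last (by omega)).into_of_headAtStart hout) ?_
  exact hanc.elim (fun h => h.trans hab) id

theorem headAtStart_of_isInducing (hG : G.HasAncestralArrowheads) (hπ : π.IsInducing)
    (hlen : 2 ≤ π.len) {k : ℕ} (hk : k < π.len) : (π.edge k).HeadAtStart := by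
  rcases Nat.eq_zero_or_pos k with rfl | h0
  · by_contra htail
    rcases (π.hasEdge_first hk).und_or_dir_of_not_headAtStart htail with ⟨-, h⟩ | ⟨hdir, -⟩
    · exact h (hπ 1 (by omega) (by omega)).1.2.2.1
    · exact hG.not_ancestor_of_isInducing hπ hlen ((hG.ancestor_of_isInducing hπ hlen).head hdir)
  · exact (hπ k h0 hk).1.2.2.2

theorem edge_eq_bid_of_isInducing (hG : G.HasAncestralArrowheads) (hπ : π.IsInducing)
    (hlen : 2 ≤ π.len) {k : ℕ} (hk : k < π.len) : π.edge k = .bid := by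
  have hrev : (π.edge (π.len - 1 - (π.len - 1 - k))).flip.HeadAtStart :=
    hG.headAtStart_of_isInducing hπ.reverse hlen (k := π.len - 1 - k)
      (show π.len - 1 - k < π.len by omega)
  rw [EdgeType.headAtStart_flip, Nat.sub_sub_self (by omega)] at hrev
  exact EdgeType.eq_bid (hG.headAtStart_of_isInducing hπ hlen hk) hrev

end HasAncestralArrowheads

end Inducing

section BidClosure

variable {a b : V} {e : EdgeType}

/-- `a` and `b` are distinct, not adjacent, and the endpoints of an inducing path; a maximal
extension has to join them by an edge. -/
def InducingPair (G : LMG V) (a b : V) : Prop :=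
  a ≠ b ∧ ¬ G.Adj a b ∧ ∃ π : G.Path a b, π.IsInducing

theorem InducingPair.symm (h : G.InducingPair a b) : G.InducingPair b a :=
  let ⟨hab, hadj, π, hπ⟩ := h
  ⟨hab.symm, fun h => hadj h.symm, π.reverse, hπ.reverse⟩

/-- The graph obtained from `G` by adding a bidirected edge between the endpoints of each inducing
pair. It is the maximal extension of `G` if `G` is strongly ribbonless. -/
def bidClosure (G : LMG V) : LMG V where
  und := G.und
  dir := G.dir
  bid a b := G.bid a b ∨ G.InducingPair a b
  und_symm := G.und_symm
  bid_symm i j h := h.imp (G.bid_symm i j) InducingPair.symm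
  und_loopless := G.und_loopless
  dir_loopless := G.dir_loopless
  bid_loopless i h := h.elim (G.bid_loopless i) fun h => h.1 rfl

theorem hasEdge_bidClosure_iff :
    G.bidClosure.HasEdge e a b ↔ G.HasEdge e a b ∨ (e = .bid ∧ G.InducingPair a b) := by
  cases e <;> simp [HasEdge, bidClosure]

theorem into_bidClosure_iff :
    G.bidClosure.Into a b ↔ G.Into a b ∨ G.InducingPair a b :=
  or_assoc.symm

theorem isContainedIn_bidClosure (G : LMG V) : G.IsContainedIn G.bidClosure :=
  fun _ _ _ h => hasEdge_bidClosure_iff.2 (Or.inl h)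

theorem adj_bidClosure_iff : G.bidClosure.Adj a b ↔ G.Adj a b ∨ G.InducingPair a b := by
  simp only [Adj, hasEdge_bidClosure_iff, exists_or, exists_eq_left]

theorem HasAncestralArrowheads.exists_bid_of_inducingPair (hG : G.HasAncestralArrowheads)
    (h : G.InducingPair a b) : ∃ c, G.bid c b := by
  obtain ⟨hab, hadj, π, hπ⟩ := h
  have hlen := π.two_le_len hab hadj
  have hlast := π.hasEdge_last (by omega)
  rw [hG.edge_eq_bid_of_isInducing hπ hlen (by omega)] at hlast
  exact ⟨_, hlast⟩

theorem HasAncestralArrowheads.not_ancestor_of_inducingPair (hG : G.HasAncestralArrowheads)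
    (h : G.InducingPair a b) : ¬ G.Ancestor a b :=
  let ⟨hab, hadj, π, hπ⟩ := h
  hG.not_ancestor_of_isInducing hπ (π.two_le_len hab hadj)

theorem HasAncestralArrowheads.bidClosure (hG : G.HasAncestralArrowheads) :
    G.bidClosure.HasAncestralArrowheads := by
  intro i j hij
  rcases into_bidClosure_iff.1 hij with h | h
  exacts [hG h, hG.not_ancestor_of_inducingPair h.symm]

theorem IsAncestral.bidClosure (hG : G.IsAncestral) : G.bidClosure.IsAncestral := by
  refine isAncestral_iff.2 ⟨hG.hasAncestralArrowheads.bidClosure, fun i hi k hk => ?_⟩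
  rcases into_bidClosure_iff.1 hk with h | h
  · exact hG.not_into hi k h
  · obtain ⟨c, hc⟩ := hG.hasAncestralArrowheads.exists_bid_of_inducingPair h
    exact hG.not_into hi c (Or.inr hc)

/-- The second node of an inducing path from `a` is an ancestor of `b`, so besides the last edge
`c ↔ b` of the path there is an edge `d → b`, and `d ≠ c`. -/
theorem IsStronglyRibbonless.selectionFree_of_inducingPair (hG : G.IsStronglyRibbonless)
    (h : G.InducingPair a b) : G.SelectionFree b := by
  have harr := hG.hasAncestralArrowheads
  obtain ⟨c, hc⟩ := harr.exists_bid_of_inducingPair h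
  obtain ⟨hab, hadj, π, hπ⟩ := h
  obtain ⟨d, -, hd⟩ :=
    Relation.TransGen.tail'_iff.1 (harr.ancestor_of_isInducing hπ (π.two_le_len hab hadj))
  refine hG.selectionFree (fun hdc => ?_) (Or.inl hd) (Or.inr hc)
  exact harr (Or.inr (G.bid_symm _ _ hc)) (.single (hdc ▸ hd))

theorem IsStronglyRibbonless.bidClosure (hG : G.IsStronglyRibbonless) :
    G.bidClosure.IsStronglyRibbonless where
  hasAncestralArrowheads := hG.hasAncestralArrowheads.bidClosure
  selectionFree i j k hik hi hk := by
    rcases into_bidClosure_iff.1 hi with hi | hi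
    · rcases into_bidClosure_iff.1 hk with hk | hk
      exacts [hG.selectionFree hik hi hk, hG.selectionFree_of_inducingPair hk]
    · exact hG.selectionFree_of_inducingPair hi

end BidClosure

/-! ### Connecting walks -/

/-- The node `v` does not block a walk given `C`, where `col` says whether it is a collider. -/
def Unblocked (G : LMG V) (C : Set V) (v : V) (col : Prop) : Prop :=
  (col → v ∈ C ∨ ∃ c ∈ C, G.Ancestor v c) ∧ (¬ col → v ∉ C)

/-- No inner node of the path blocks it given `C`. -/
def Path.IsUnblocked {a b : V} (π : G.Path a b) (C : Set V) : Prop :=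
  ∀ k, k + 1 < π.len →
    G.Unblocked C (π.vert (k + 1)) ((π.edge k).HeadAtEnd ∧ (π.edge (k + 1)).HeadAtStart)

theorem Path.mConnecting_iff {a b : V} {π : G.Path a b} {C : Set V} :
    π.MConnecting C ↔ a ∉ C ∧ b ∉ C ∧ π.IsUnblocked C := by
  constructor
  · intro h
    refine ⟨?_, ?_, fun k hk => ?_⟩
    · simpa only [π.vert_zero] using (h 0 (Nat.zero_le _)).2 fun hc => lt_irrefl _ hc.1
    · simpa only [π.vert_len] using (h π.len le_rfl).2 fun hc => lt_irrefl _ hc.2.1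
    · simpa only [Unblocked, isCollider_succ, hk, true_and] using h (k + 1) hk.le
  · rintro ⟨ha, hb, h⟩ (_ | k) hk
    · exact ⟨fun hc => (lt_irrefl _ hc.1).elim, fun _ => by rwa [π.vert_zero]⟩
    · rcases hk.eq_or_lt with hk | hk
      · refine ⟨fun hc => (hk.not_lt hc.2.1).elim, fun _ => ?_⟩
        rwa [hk, π.vert_len]
      · simpa only [Unblocked, isCollider_succ, hk, true_and] using h k hk

/-- `G.ConnWalk C a p b q`: there is a walk from `a` to `b` with at least one edge, none of whose
inner nodes blocks it given `C`; `p` and `q` say whether its first edge has an arrowhead at `a`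
and its last edge one at `b`. -/
inductive ConnWalk (G : LMG V) (C : Set V) : V → Prop → V → Prop → Prop
  | single {e : EdgeType} {a b : V} (h : G.HasEdge e a b) :
      ConnWalk G C a e.HeadAtStart b e.HeadAtEnd
  | cons {a b c : V} {p q : Prop} {e : EdgeType} (h : G.HasEdge e a b)
      (hb : G.Unblocked C b (e.HeadAtEnd ∧ p)) (hw : ConnWalk G C b p c q) :
      ConnWalk G C a e.HeadAtStart c q

namespace ConnWalk

variable {C : Set V} {a b c : V} {p q r s : Prop}

theorem trans (h : G.ConnWalk C a p b q) (hb : G.Unblocked C b (q ∧ r))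
    (h' : G.ConnWalk C b r c s) : G.ConnWalk C a p c s := by
  induction h with
  | single he => exact h'.cons he hb
  | cons he hopen _ ih => exact (ih hb h').cons he hopen

theorem symm (h : G.ConnWalk C a p b q) : G.ConnWalk C b q a p := by
  induction h with
  | @single e _ _ he =>
    simpa only [e.headAtStart_flip, e.headAtEnd_flip] using single (C := C) he.flip
  | @cons _ _ _ _ _ e he hopen _ ih =>
    have hflip := single (C := C) he.flip
    rw [e.headAtStart_flip, e.headAtEnd_flip] at hflip
    exact ih.trans (and_comm.eq ▸ hopen) hflip

theorem of_ancestor (h : G.Ancestor a b) (ha : ∀ c ∈ C, ¬ G.Ancestor a c) :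
    G.ConnWalk C a False b True := by
  induction h with
  | single h => exact single (e := .fwd) h
  | tail h h' ih =>
    exact ih.trans ⟨fun hcol => hcol.2.elim, fun _ hC => ha _ hC h⟩ (single (e := .fwd) h')

/-- From an inner node of the path that blocks it given `C`, hence is no ancestor of `C`, the walk
turns to the endpoint of which this node is an ancestor. -/
theorem of_bidirected_isInducing {π : G.Path a b} (hπ : π.IsInducing) (hlen : 0 < π.len)
    (hbid : ∀ k < π.len, π.edge k = .bid) : G.ConnWalk C a True b True := by
  have edge (k : ℕ) (hk : k < π.len) : G.ConnWalk C (π.vert k) True (π.vert (k + 1)) True :=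
    single (e := .bid) (hbid k hk ▸ π.hasEdge k hk)
  have walk_to_vert : ∀ k < π.len,
      G.ConnWalk C a True (π.vert (k + 1)) True ∨ G.ConnWalk C a True b True := by
    intro k
    induction k with
    | zero => exact fun h0 => Or.inl (by simpa only [π.vert_zero] using edge 0 h0)
    | succ k ih =>
      intro hk
      refine (ih (by omega)).elim (fun hw => ?_) Or.inr
      by_cases hcol : π.vert (k + 1) ∈ C ∨ ∃ c ∈ C, G.Ancestor (π.vert (k + 1)) c
      · exact Or.inl (hw.trans ⟨fun _ => hcol, fun h => (h ⟨trivial, trivial⟩).elim⟩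
          (edge (k + 1) hk))
      push Not at hcol
      rcases (hπ (k + 1) k.succ_pos hk).2 with ha | hb
      · exact Or.inl ((of_ancestor ha hcol.2).symm.trans
          ⟨fun h => h.1.elim, fun _ => hcol.1⟩ (edge (k + 1) hk))
      · exact Or.inr (hw.trans ⟨fun h => h.2.elim, fun _ => hcol.1⟩ (of_ancestor hb hcol.2))
  simpa only [Nat.sub_add_cancel hlen, π.vert_len, or_self] using
    walk_to_vert (π.len - 1) (by omega)

theorem of_edges (h : H.ConnWalk C a p b q) (hanc : H.Ancestor = G.Ancestor)
    (hedge : ∀ e i j, H.HasEdge e i j → G.ConnWalk C i e.HeadAtStart j e.HeadAtEnd) :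
    G.ConnWalk C a p b q := by
  induction h with
  | single h => exact hedge _ _ _ h
  | cons h hopen _ ih =>
    unfold Unblocked at hopen
    rw [hanc] at hopen
    exact (hedge _ _ _ h).trans hopen ih

/-- The walk follows directed edges as long as it meets neither an undirected edge nor a
collider. -/
theorem ancestor_of_tail (h : G.ConnWalk C a p b q) (hp : ¬ p) :
    ¬ G.SelectionFree a ∨ (∃ c ∈ C, G.Ancestor a c) ∨ G.Ancestor a b := by
  induction h with
  | single he =>
    rcases he.und_or_dir_of_not_headAtStart hp with ⟨hund, -⟩ | ⟨hdir, -⟩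
    exacts [Or.inl fun h => h _ .refl ⟨_, hund⟩, Or.inr (Or.inr (.single hdir))]
  | @cons a b _ p _ _ he hopen _ ih =>
    rcases he.und_or_dir_of_not_headAtStart hp with ⟨hund, -⟩ | ⟨hdir, hhead⟩
    · exact Or.inl fun h => h _ .refl ⟨_, hund⟩
    by_cases hp' : p
    · rcases hopen.1 ⟨hhead, hp'⟩ with hC | ⟨c, hc, hbc⟩
      exacts [Or.inr (Or.inl ⟨b, hC, .single hdir⟩), Or.inr (Or.inl ⟨c, hc, hbc.head hdir⟩)]
    · rcases ih hp' with hb | ⟨c, hc, hbc⟩ | hbc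
      exacts [Or.inl fun h => hb (h.of_ancestor (.single hdir)),
        Or.inr (Or.inl ⟨c, hc, hbc.head hdir⟩), Or.inr (Or.inr (hbc.head hdir))]

end ConnWalk

namespace Path

variable {C : Set V} {a b : V} {π : G.Path a b}

theorem IsUnblocked.connWalk (hπ : π.IsUnblocked C) (k d : ℕ) (h : k + d < π.len) :
    G.ConnWalk C (π.vert k) (π.edge k).HeadAtStart (π.vert (k + d + 1))
      (π.edge (k + d)).HeadAtEnd := by
  induction d with
  | zero => exact .single (π.hasEdge k h)
  | succ d ih =>
    exact (ih (by omega)).trans (hπ (k + d) h) (.single (π.hasEdge (k + d + 1) h))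

theorem IsUnblocked.connWalk_left (hπ : π.IsUnblocked C) {k : ℕ} (hk : k < π.len) :
    G.ConnWalk C a (π.edge 0).HeadAtStart (π.vert (k + 1)) (π.edge k).HeadAtEnd := by
  simpa only [π.vert_zero, zero_add] using hπ.connWalk 0 k (by omega)

theorem IsUnblocked.connWalk_right (hπ : π.IsUnblocked C) {k : ℕ} (hk : k < π.len) :
    ∃ q, G.ConnWalk C (π.vert k) (π.edge k).HeadAtStart b q := by
  obtain ⟨d, hd⟩ := Nat.exists_eq_add_of_lt hk
  have hw := hπ.connWalk k d (by omega)
  rw [← hd, π.vert_len] at hw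
  exact ⟨_, hw⟩

end Path

section Shortening

variable {C : Set V} {a b c : V} {p q r : Prop}

/-- A walk that leaves `a` with mark `p` can instead leave it with mark `r`: either the marks agree,
or a closed walk starting with mark `p` returns to `a` such that leaving with mark `r` does not
block it given `C`. The passage back is used to cut such a closed walk off. -/
def CanReenter (G : LMG V) (C : Set V) (a : V) (p r : Prop) : Prop :=
  r = p ∨ ∃ s, G.ConnWalk C a p a s ∧ G.Unblocked C a (s ∧ r)

theorem CanReenter.connWalk (h : G.CanReenter C a p r) (hw : G.ConnWalk C a r b q) :
    G.ConnWalk C a p b q := by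
  rcases h with rfl | ⟨s, hloop, hopen⟩
  exacts [hw, hloop.trans hopen hw]

/-- If cutting off the closed walk turns `a` into a collider that is no ancestor of `C`, then the
closed walk leaves `a` through a tail, so it is a directed cycle. -/
theorem CanReenter.unblocked (h : G.CanReenter C a p r) (ha : ¬ G.Ancestor a a)
    (hopen : G.Unblocked C a (q ∧ p)) (hsel : q → r → G.SelectionFree a) :
    G.Unblocked C a (q ∧ r) := by
  rcases h with rfl | ⟨s, hloop, hopen'⟩
  · exact hopen
  refine ⟨?_, fun hqr hC => ?_⟩
  · rintro ⟨hq, hr⟩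
    by_cases hp : p
    · exact hopen.1 ⟨hq, hp⟩
    rcases hloop.ancestor_of_tail hp with h | h | h
    exacts [(h (hsel hq hr)).elim, Or.inr h, (ha h).elim]
  · by_cases hq : q
    exacts [hopen'.2 (fun h => hqr ⟨hq, h.2⟩) hC, hopen.2 (fun h => hq h.1) hC]

theorem Path.isUnblocked_cons {e : EdgeType} (h : G.HasEdge e a b) {π : G.Path b c}
    (ha : ∀ k ≤ π.len, π.vert k ≠ a) (hπ : π.IsUnblocked C)
    (hb : 0 < π.len → G.Unblocked C b (e.HeadAtEnd ∧ (π.edge 0).HeadAtStart)) :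
    (cons h π ha).IsUnblocked C := by
  rintro (_ | k) hk
  · change G.Unblocked C (π.vert 0) _
    rw [π.vert_zero]
    exact hb (Nat.lt_of_succ_lt_succ hk)
  · exact hπ k (Nat.lt_of_succ_lt_succ hk)

theorem Path.isUnblocked_ofEdge {e : EdgeType} (h : G.HasEdge e a b) :
    (ofEdge h).IsUnblocked C :=
  isUnblocked_cons h _ (fun k hk => absurd hk k.succ_pos.not_gt) fun h0 => absurd h0 (lt_irrefl 0)

theorem Path.IsUnblocked.drop {π : G.Path a b} (hπ : π.IsUnblocked C) {k : ℕ} (hk : k ≤ π.len) :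
    (π.drop k hk).IsUnblocked C :=
  fun l (hl : l + 1 < π.len - k) => hπ (k + l) (by omega)

theorem ConnWalk.exists_isUnblocked (hG : G.IsStronglyRibbonless) (h : G.ConnWalk C a p b q) :
    ∃ π : G.Path a b, π.IsUnblocked C ∧
      (0 < π.len → G.CanReenter C a p (π.edge 0).HeadAtStart) := by
  induction h with
  | single he =>
    exact ⟨.ofEdge he, Path.isUnblocked_ofEdge he, fun _ => Or.inl rfl⟩
  | @cons a b _ _ _ _ he hopen _ ih =>
    obtain ⟨π, hπ, hstart⟩ := ih
    by_cases hmem : ∃ k ≤ π.len, π.vert k = a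
    · obtain ⟨_ | k, hk, rfl⟩ := hmem
      · exact absurd π.vert_zero he.ne
      refine ⟨π.drop (k + 1) hk, hπ.drop hk, fun hlen => Or.inr ⟨_, ?_, hπ k ?_⟩⟩
      · exact ((hstart (by omega)).connWalk (hπ.connWalk_left hk)).cons he hopen
      · exact Nat.lt_of_sub_pos hlen
    · push Not at hmem
      refine ⟨π.cons he hmem, Path.isUnblocked_cons he hmem hπ fun hlen => ?_, fun _ => Or.inl rfl⟩
      refine (hstart hlen).unblocked (hG.hasAncestralArrowheads.not_ancestor_self b) hopen
        fun hin hout => ?_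
      exact hG.selectionFree (hmem 1 hlen).symm (he.into_of_headAtEnd hin)
        ((π.hasEdge_first hlen).into_of_headAtStart hout)

theorem ConnWalk.exists_mConnecting (hG : G.IsStronglyRibbonless) (h : G.ConnWalk C a p b q)
    (ha : a ∉ C) (hb : b ∉ C) : ∃ π : G.Path a b, π.MConnecting C :=
  let ⟨π, hπ, _⟩ := h.exists_isUnblocked hG
  ⟨π, Path.mConnecting_iff.2 ⟨ha, hb, hπ⟩⟩

end Shortening

/-! ### Markov equivalence and maximality -/

section Markov

variable {a b : V} {e : EdgeType} {C : Set V} {p q : Prop}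

theorem independenceModel_subset (h : ∀ ⦃C a b⦄ (π : G.Path a b), π.MConnecting C → a ≠ b →
    ∃ ρ : H.Path a b, ρ.MConnecting C) : H.independenceModel ⊆ G.independenceModel := by
  rintro ⟨A, B, C⟩ ⟨hAB, hAC, hBC, hsep⟩
  refine ⟨hAB, hAC, hBC, fun a ha b hb π hπ => ?_⟩
  obtain ⟨ρ, hρ⟩ := h π hπ (hAB.ne_of_mem ha hb)
  exact hsep a ha b hb ρ hρ

theorem IsContainedIn.independenceModel_subset (hGH : G.IsContainedIn H)
    (hanc : H.Ancestor = G.Ancestor) : H.independenceModel ⊆ G.independenceModel := by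
  refine LMG.independenceModel_subset fun C a b π hπ _ =>
    ⟨π.map (.refl V) hGH, fun k hk => ?_⟩
  rw [hanc]
  exact hπ k hk

theorem HasAncestralArrowheads.connWalk_of_bidClosure (hG : G.HasAncestralArrowheads)
    (h : G.bidClosure.ConnWalk C a p b q) : G.ConnWalk C a p b q := by
  refine h.of_edges rfl fun e i j he => ?_
  rcases hasEdge_bidClosure_iff.1 he with he | ⟨rfl, hij, hadj, π, hπ⟩
  · exact .single he
  · have hlen := π.two_le_len hij hadj
    exact .of_bidirected_isInducing hπ (by omega) fun k hk =>
      hG.edge_eq_bid_of_isInducing hπ hlen hk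

namespace IsStronglyRibbonless

theorem independenceModel_subset_bidClosure (hG : G.IsStronglyRibbonless) :
    G.independenceModel ⊆ G.bidClosure.independenceModel := by
  refine LMG.independenceModel_subset fun C a b π hπ hab => ?_
  obtain ⟨ha, hb, hopen⟩ := Path.mConnecting_iff.1 hπ
  obtain ⟨q, hwalk⟩ := hopen.connWalk_right (π.len_pos hab)
  rw [π.vert_zero] at hwalk
  exact (hG.hasAncestralArrowheads.connWalk_of_bidClosure hwalk).exists_mConnecting hG ha hb

theorem markovEquiv_of_between (hG : G.IsStronglyRibbonless) (hGH : G.IsContainedIn H)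
    (hH : H.IsContainedIn G.bidClosure) : H.MarkovEquiv G := by
  have hanc : H.Ancestor = G.Ancestor := by
    ext i j
    exact ⟨hH.ancestor, hGH.ancestor⟩
  exact (hGH.independenceModel_subset hanc).antisymm
    (hG.independenceModel_subset_bidClosure.trans (hH.independenceModel_subset hanc.symm))

theorem markovEquiv_bidClosure (hG : G.IsStronglyRibbonless) : G.bidClosure.MarkovEquiv G :=
  hG.markovEquiv_of_between G.isContainedIn_bidClosure fun _ _ _ h => h

end IsStronglyRibbonless

/-- `v` reaches `a`, `b` or an endpoint of an undirected edge along directed edges. -/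
def Anterior (G : LMG V) (a b v : V) : Prop :=
  G.Ancestor v a ∨ G.Ancestor v b ∨ ¬ G.SelectionFree v

theorem Anterior.of_ancestor {v w : V} (hw : G.Anterior a b w) (h : G.Ancestor v w) :
    G.Anterior a b v :=
  hw.imp h.trans (Or.imp h.trans fun hw hv => hw (hv.of_ancestor h))

/-- The set of nodes that separates `a` and `b` if these are not adjacent in `G.bidClosure`. -/
def separator (G : LMG V) (a b : V) : Set V := {v | v ≠ a ∧ v ≠ b ∧ G.Anterior a b v}

theorem ConnWalk.anterior_of_tail {v w : V} (h : G.ConnWalk (G.separator a b) v p w q) (hp : ¬ p)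
    (hw : w = a ∨ w = b) : G.Anterior a b v := by
  rcases h.ancestor_of_tail hp with hv | ⟨c, hc, hvc⟩ | hvw
  · exact Or.inr (Or.inr hv)
  · exact hc.2.2.of_ancestor hvc
  · rcases hw with rfl | rfl
    exacts [Or.inl hvw, Or.inr (Or.inl hvw)]

theorem IsStronglyRibbonless.isInducing_of_mConnecting_separator (hG : G.IsStronglyRibbonless)
    {π : G.Path a b} (hπ : π.MConnecting (G.separator a b)) : π.IsInducing := by
  intro k h0 hk
  obtain ⟨-, -, hopen⟩ := Path.mConnecting_iff.1 hπ
  by_cases hcol : π.IsCollider k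
  · have hant : G.Anterior a b (π.vert k) := by
      rcases (hπ k hk.le).1 hcol with h | ⟨c, hc, h⟩
      exacts [h.2.2, hc.2.2.of_ancestor h]
    obtain ⟨i, j, hij, hi, hj⟩ := hcol.exists_into
    have hfree := hG.selectionFree hij hi hj
    exact ⟨hcol, hant.imp_right fun h => h.resolve_right (not_not.2 hfree)⟩
  · refine ((hπ k hk.le).2 hcol ⟨π.vert_ne_left h0 hk.le, π.vert_ne_right hk, ?_⟩).elim
    obtain ⟨k, rfl⟩ := Nat.exists_eq_add_one_of_ne_zero h0.ne'
    by_cases hout : (π.edge (k + 1)).HeadAtStart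
    · have hin : ¬ (π.edge k).HeadAtEnd := fun hin => hcol ⟨h0, hk, hin, hout⟩
      exact (hopen.connWalk_left (by omega)).symm.anterior_of_tail hin (Or.inl rfl)
    · obtain ⟨q, hwalk⟩ := hopen.connWalk_right hk
      exact hwalk.anterior_of_tail hout (Or.inr rfl)

theorem Adj.not_mem_independenceModel (h : G.Adj a b) : ({a}, {b}, C) ∉ G.independenceModel := by
  rintro ⟨-, ha, hb, hsep⟩
  obtain ⟨e, he⟩ := h
  refine hsep a rfl b rfl (.ofEdge he) (Path.mConnecting_iff.2
    ⟨Set.disjoint_singleton_left.1 ha, Set.disjoint_singleton_left.1 hb,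
      Path.isUnblocked_ofEdge he⟩)

namespace IsStronglyRibbonless

theorem separator_mem_independenceModel (hG : G.IsStronglyRibbonless) (hab : a ≠ b)
    (hadj : ¬ G.bidClosure.Adj a b) : ({a}, {b}, G.separator a b) ∈ G.independenceModel := by
  refine ⟨Set.disjoint_singleton.2 hab, Set.disjoint_singleton_left.2 fun h => h.1 rfl,
    Set.disjoint_singleton_left.2 fun h => h.2.1 rfl, ?_⟩
  rintro _ rfl _ rfl π hπ
  rw [adj_bidClosure_iff, not_or] at hadj
  exact hadj.2 ⟨hab, hadj.1, π, hG.isInducing_of_mConnecting_separator hπ⟩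

theorem isMaximal_bidClosure (hG : G.IsStronglyRibbonless) : G.bidClosure.IsMaximal := by
  intro e a b hab hadj hequiv
  have hadd : (G.bidClosure.addEdge e a b hab).Adj a b := ⟨e, hasEdge_addEdge hab⟩
  refine hadd.not_mem_independenceModel (C := G.separator a b) ?_
  rw [hequiv, hG.markovEquiv_bidClosure]
  exact hG.separator_mem_independenceModel hab hadj

theorem eq_bidClosure_of_isMaximal (hG : G.IsStronglyRibbonless) (hGH : G.IsContainedIn H)
    (hH : H.IsContainedIn G.bidClosure) (hmax : H.IsMaximal) : H = G.bidClosure := by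
  refine hH.antisymm fun e a b he => ?_
  by_contra hnot
  obtain ⟨rfl, hpair⟩ :=
    (hasEdge_bidClosure_iff.1 he).resolve_left fun h => hnot (hGH _ _ _ h)
  have hadj : ¬ H.Adj a b := by
    rintro ⟨f, hf⟩
    rcases hasEdge_bidClosure_iff.1 (hH _ _ _ hf) with h | ⟨rfl, -⟩
    exacts [hpair.2.1 ⟨f, h⟩, hnot hf]
  have hadd : (H.addEdge .bid a b hpair.1).MarkovEquiv G :=
    hG.markovEquiv_of_between (fun _ _ _ h => isContainedIn_addEdge hpair.1 _ _ _ (hGH _ _ _ h))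
      (addEdge_isContainedIn hH he)
  exact hmax _ _ _ hpair.1 hadj (Eq.trans hadd (hG.markovEquiv_of_between hGH hH).symm)

end IsStronglyRibbonless

theorem HasAncestralArrowheads.endpointIdentical_iff (hG : G.HasAncestralArrowheads)
    {π : G.Path a b} (hπ : π.IsInducing) (hlen : 2 ≤ π.len) :
    π.EndpointIdentical e ↔ e = .bid := by
  rw [Path.EndpointIdentical, hG.edge_eq_bid_of_isInducing hπ hlen (by omega),
    hG.edge_eq_bid_of_isInducing hπ hlen (by omega)]
  constructor
  · exact fun h => EdgeType.eq_bid (h.2.1.2 trivial) (h.2.2.2 trivial)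
  · rintro rfl
    exact ⟨by omega, Iff.rfl, Iff.rfl⟩

theorem IsStronglyRibbonless.isMaximalRibbonlessExtension_iff (hG : G.IsStronglyRibbonless) :
    G.IsMaximalRibbonlessExtension H ↔ H = G.bidClosure := by
  have harr := hG.hasAncestralArrowheads
  constructor
  · intro hH
    refine hG.eq_bidClosure_of_isMaximal hH.contains (fun e a b he => ?_) hH.maximal
    refine hasEdge_bidClosure_iff.2 (or_iff_not_imp_left.2 fun hnot => ?_)
    obtain ⟨hadj, π, hπ, hend⟩ := hH.added e a b he hnot
    have hlen := π.two_le_len he.ne hadj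
    exact ⟨(harr.endpointIdentical_iff hπ hlen).1 hend, he.ne, hadj, π, hπ⟩
  · rintro rfl
    refine ⟨G.isContainedIn_bidClosure, hG.bidClosure.isRibbonless, hG.isMaximal_bidClosure,
      hG.markovEquiv_bidClosure, fun e a b he hnot => ?_⟩
    obtain ⟨rfl, hab, hadj, π, hπ⟩ := (hasEdge_bidClosure_iff.1 he).resolve_left hnot
    exact ⟨hadj, π, hπ, (harr.endpointIdentical_iff hπ (π.two_le_len hab hadj)).2 rfl⟩

theorem IsAncestral.eq_bid_of_isInducing (hG : G.IsAncestral) {π : G.Path a b}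
    (hπ : π.IsInducing) (hlen : 2 ≤ π.len) (he : G.HasEdge e a b) : e = .bid := by
  have harr := hG.hasAncestralArrowheads
  have into_start := (π.hasEdge_first (by omega)).into_of_headAtStart
    (harr.headAtStart_of_isInducing hπ hlen (by omega))
  cases e
  · exact (hG.not_into ⟨b, he⟩ _ into_start).elim
  · exact (harr.not_ancestor_of_isInducing hπ hlen (.single he)).elim
  · exact (harr.not_ancestor_of_isInducing hπ.reverse hlen (.single he)).elim
  · rfl

theorem IsAncestral.isMaximalAncestralExtension_iff (hG : G.IsAncestral) :
    G.IsMaximalAncestralExtension H ↔ H = G.bidClosure := by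
  have hstrong := hG.isStronglyRibbonless
  constructor
  · intro hH
    refine hstrong.eq_bidClosure_of_isMaximal hH.contains (fun e a b he => ?_) hH.maximal
    have hadj : G.bidClosure.Adj a b := by
      by_contra hadj
      refine Adj.not_mem_independenceModel ⟨e, he⟩ (C := G.separator a b) ?_
      rw [hH.markovEquiv]
      exact hstrong.separator_mem_independenceModel he.ne hadj
    rw [adj_bidClosure_iff] at hadj
    obtain ⟨f, hf⟩ | ⟨hab, hadj, π, hπ⟩ := hadj
    · rw [hH.ancestral.edge_unique he (hH.contains _ _ _ hf)]
      exact G.isContainedIn_bidClosure _ _ _ hf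
    · have hmap : (π.map (.refl V) hH.contains).IsInducing := hπ.map (f := .refl V) hH.contains
      exact hasEdge_bidClosure_iff.2 (Or.inr ⟨hH.ancestral.eq_bid_of_isInducing hmap
        (π.two_le_len hab hadj) he, hab, hadj, π, hπ⟩)
  · rintro rfl
    exact ⟨G.isContainedIn_bidClosure, hG.bidClosure, hstrong.isMaximal_bidClosure,
      hstrong.markovEquiv_bidClosure⟩

end Markov

/-! ### Interventional graphs -/

section Interventional

variable {ι : Type*} {I : ι → Set V} {e : EdgeType} {i j : V}
  {x y : V ⊕ {t : ι // (I t).Nonempty}}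

theorem hasEdge_interventional_inl_iff :
    (G.interventional I).HasEdge e (.inl i) (.inl j) ↔ G.HasEdge e i j := by
  cases e <;> simp [HasEdge, interventional]

theorem not_into_interventional_inr {t : {t : ι // (I t).Nonempty}} :
    ¬ (G.interventional I).Into x (.inr t) := by
  simp [Into, interventional]

theorem into_interventional_inl_iff : (G.interventional I).Into x (.inl i) ↔
    (∃ j, x = .inl j ∧ G.Into j i) ∨ ∃ t, x = .inr t ∧ i ∈ I t.1 := by
  simp only [Into, interventional]
  aesop

theorem dir_interventional_inl_iff :
    (G.interventional I).dir (.inl i) y ↔ ∃ j, y = .inl j ∧ G.dir i j := by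
  simp [interventional]

theorem ancestor_interventional_inl_iff :
    (G.interventional I).Ancestor (.inl i) y ↔ ∃ j, y = .inl j ∧ G.Ancestor i j := by
  constructor
  · intro h
    induction h with
    | single h =>
      obtain ⟨j, rfl, hij⟩ := dir_interventional_inl_iff.1 h
      exact ⟨j, rfl, .single hij⟩
    | tail _ h ih =>
      obtain ⟨j, rfl, hij⟩ := ih
      obtain ⟨k, rfl, hjk⟩ := dir_interventional_inl_iff.1 h
      exact ⟨k, rfl, hij.tail hjk⟩
  · rintro ⟨j, rfl, h⟩
    exact h.lift Sum.inl fun _ _ => (hasEdge_interventional_inl_iff (e := .fwd)).2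

theorem SelectionFree.interventional (hi : G.SelectionFree i) :
    (G.interventional I).SelectionFree (.inl i) := by
  rintro d hid ⟨_, d', _, rfl, rfl, hd⟩
  refine hi d' ?_ ⟨_, hd⟩
  rw [Relation.reflTransGen_iff_eq_or_transGen] at hid ⊢
  refine hid.imp Sum.inl.inj fun h => ?_
  obtain ⟨j, hj, hij⟩ := ancestor_interventional_inl_iff.1 h
  exact Sum.inl.inj hj ▸ hij

theorem HasAncestralArrowheads.interventional (hG : G.HasAncestralArrowheads) :
    (G.interventional I).HasAncestralArrowheads := by
  rintro x (i | t) hx hanc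
  · obtain ⟨j, rfl, hij⟩ := ancestor_interventional_inl_iff.1 hanc
    rcases into_interventional_inl_iff.1 hx with ⟨_, h, hji⟩ | ⟨_, h, -⟩
    · cases h
      exact hG hji hij
    · cases h
  · exact not_into_interventional_inr hx

theorem IsAncestral.isStronglyRibbonless_interventional (hG : G.IsAncestral)
    (hI : ∀ i, G.SelectionAdjacent i → ¬ DoublyIntervenes I i) :
    (G.interventional I).IsStronglyRibbonless where
  hasAncestralArrowheads := hG.hasAncestralArrowheads.interventional
  selectionFree := by
    rintro x (i | t) z hxz hx hz
    swap
    · exact (not_into_interventional_inr hx).elim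
    refine SelectionFree.interventional ?_
    rcases into_interventional_inl_iff.1 hx with ⟨j, -, hj⟩ | ⟨s, rfl, hs⟩
    · exact hG.selectionFree_of_into hj
    rcases into_interventional_inl_iff.1 hz with ⟨j, -, hj⟩ | ⟨t, rfl, ht⟩
    · exact hG.selectionFree_of_into hj
    have hdouble : DoublyIntervenes I i :=
      ⟨s, t, fun h => hxz (congrArg Sum.inr (Subtype.ext h)), hs, ht⟩
    intro d hid hd
    rcases Relation.ReflTransGen.cases_tail hid with rfl | ⟨k, -, hk⟩
    exacts [hI _ hd hdouble, hG.not_into hd k (Or.inl hk)]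

theorem exists_isInducing_of_interventional
    {π : (G.interventional I).Path (.inl i) (.inl j)} (hπ : π.IsInducing)
    (hvert : ∀ k ≤ π.len, ∃ v, π.vert k = .inl v) : ∃ ρ : G.Path i j, ρ.IsInducing := by
  have : Nonempty V := ⟨i⟩
  choose! v hv using hvert
  let ρ : G.Path i j :=
    { len := π.len
      vert := v
      edge := π.edge
      vert_zero := Sum.inl.inj ((hv 0 (Nat.zero_le _)).symm.trans π.vert_zero)
      vert_len := Sum.inl.inj ((hv _ le_rfl).symm.trans π.vert_len)
      hasEdge := fun k hk => by
        have h := π.hasEdge k hk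
        rwa [hv k hk.le, hv (k + 1) hk, hasEdge_interventional_inl_iff] at h
      nodup := fun k hk l hl h => π.nodup k hk l hl (by rw [hv k hk, hv l hl, h]) }
  refine ⟨ρ, fun k h0 hk => ⟨(hπ k h0 hk).1, ?_⟩⟩
  have hanc := (hπ k h0 hk).2
  simpa only [hv k hk.le, ancestor_interventional_inl_iff, Sum.inl.injEq, exists_eq_left']
    using hanc

theorem InducingPair.interventional (h : G.InducingPair i j) :
    (G.interventional I).InducingPair (.inl i) (.inl j) := by
  obtain ⟨hij, hadj, π, hπ⟩ := h
  refine ⟨Sum.inl_injective.ne hij, ?_, _, hπ.map (f := ⟨Sum.inl, Sum.inl_injective⟩)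
    fun _ _ _ => hasEdge_interventional_inl_iff.2⟩
  rintro ⟨e, he⟩
  exact hadj ⟨e, hasEdge_interventional_inl_iff.1 he⟩

/-- All edges of the inducing path are bidirected, so it avoids the new nodes. -/
theorem HasAncestralArrowheads.exists_of_inducingPair_interventional
    (hG : G.HasAncestralArrowheads) (h : (G.interventional I).InducingPair x y) :
    ∃ i j, x = .inl i ∧ y = .inl j ∧ G.InducingPair i j := by
  obtain ⟨hxy, hadj, π, hπ⟩ := h
  have hlen := π.two_le_len hxy hadj
  have hbid (k : ℕ) (hk : k < π.len) :
      (G.interventional I).bid (π.vert k) (π.vert (k + 1)) := by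
    have h := π.hasEdge k hk
    rwa [hG.interventional.edge_eq_bid_of_isInducing hπ hlen hk] at h
  have hvert (k : ℕ) (hk : k ≤ π.len) : ∃ v, π.vert k = .inl v := by
    rcases k with _ | k
    · obtain ⟨i, -, h, -⟩ := hbid 0 (by omega)
      exact ⟨i, h⟩
    · obtain ⟨-, j, -, h, -⟩ := hbid k hk
      exact ⟨j, h⟩
  obtain ⟨i, hi⟩ := hvert 0 (Nat.zero_le _)
  obtain ⟨j, hj⟩ := hvert π.len le_rfl
  obtain rfl := π.vert_zero.symm.trans hi
  obtain rfl := π.vert_len.symm.trans hj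
  refine ⟨i, j, rfl, rfl, fun h => hxy (congrArg _ h), ?_,
    exists_isInducing_of_interventional hπ hvert⟩
  rintro ⟨e, he⟩
  exact hadj ⟨e, hasEdge_interventional_inl_iff.2 he⟩

theorem HasAncestralArrowheads.bidClosure_interventional (hG : G.HasAncestralArrowheads) :
    G.bidClosure.interventional I = (G.interventional I).bidClosure := by
  refine LMG.ext rfl rfl ?_
  ext x y
  constructor
  · rintro ⟨i, j, rfl, rfl, h | h⟩
    exacts [Or.inl ⟨i, j, rfl, rfl, h⟩, Or.inr h.interventional]
  · rintro (⟨i, j, rfl, rfl, h⟩ | h)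
    · exact ⟨i, j, rfl, rfl, Or.inl h⟩
    · obtain ⟨i, j, rfl, rfl, hij⟩ := hG.exists_of_inducingPair_interventional h
      exact ⟨i, j, rfl, rfl, Or.inr hij⟩

end Interventional

end LMG

theorem mainTheorem5_general {V ι : Type*} (G : LMG V) (hG : G.IsAncestral)
    (I : ι → Set V) (hI : ∀ i, G.SelectionAdjacent i → ¬ LMG.DoublyIntervenes I i) :
    ∃ (Gbar : LMG V) (GIbar : LMG (V ⊕ {t : ι // (I t).Nonempty})),
      (∀ H, G.IsMaximalAncestralExtension H ↔ H = Gbar) ∧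
      (∀ H, G.IsMaximalRibbonlessExtension H ↔ H = Gbar) ∧
      (∀ H, (G.interventional I).IsMaximalRibbonlessExtension H ↔ H = GIbar) ∧
      Gbar.interventional I = GIbar :=
  ⟨G.bidClosure, (G.interventional I).bidClosure,
    fun _ => hG.isMaximalAncestralExtension_iff,
    fun _ => hG.isStronglyRibbonless.isMaximalRibbonlessExtension_iff,
    fun _ => (hG.isStronglyRibbonless_interventional hI).isMaximalRibbonlessExtension_iff,
    hG.hasAncestralArrowheads.bidClosure_interventional⟩

/-- `Gbar` is the maximal extension of `G` (the only maximal ancestral one and the only maximal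
ribbonless one), `GIbar` is the maximal extension of the interventional graph, and the
interventional graph of `Gbar` is `GIbar`. -/
theorem mainTheorem5 {V ι : Type*} [Finite V] [Finite ι] (G : LMG V) (hG : G.IsAncestral)
    (I : ι → Set V) (hI : ∀ i, G.SelectionAdjacent i → ¬ LMG.DoublyIntervenes I i) :
    ∃ (Gbar : LMG V) (GIbar : LMG (V ⊕ {t : ι // (I t).Nonempty})),
      (∀ H, G.IsMaximalAncestralExtension H ↔ H = Gbar) ∧
      (∀ H, G.IsMaximalRibbonlessExtension H ↔ H = Gbar) ∧
      (∀ H, (G.interventional I).IsMaximalRibbonlessExtension H ↔ H = GIbar) ∧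
      Gbar.interventional I = GIbar :=
  mainTheorem5_general G hG I hI
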